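/- Let $\mathbf m$ be the normalized Lebesgue measure $d\theta/2\pi$ on the unit circle $\mathbb T\subset\mathbb C$. Let $\mu$ be a finite positive Borel measure on $\mathbb C$ whose support is contained in the closed unit disk $\overline{\mathbb D}$ and whose restriction to $\mathbb T$ is $w(\theta)\,d\theta$ (the image of this measure on $(0,2\pi]$ under $\theta\mapsto e^{i\theta}$), with $w\ge 0$ measurable. Consider on the space of complex polynomials one of the following two Sobolev inner products: 1. $\operatorname{ess\,sup} w<\infty$ and $\langle p,q\rangle_{\mathbf S}=\int p\,\overline{q}\,d\mathbf m+\int p'\,\overline{q'}\,d\mu$; 2. $\operatorname{ess\,inf} w>0$ and $\langle p,q\rangle_{\mathbf S}=\int p\,\overline{q}\,d\mu+\int p'\,\overline{q'}\,d\mathbf m$. In each of the two cases there is a sequence $(\varphi_n)_{n\ge 0}$ of polynomials, $\varphi_n$ of degree exactly $n$, that is orthonormal for $\langle\cdot,\cdot\rangle_{\mathbf S}$, and for every such sequence the set of zeros $\{z\in\mathbb C:\ \varphi_n(z)=0 \text{ for some } n\ge 0\}$ is bounded. -/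

import Mathlib

open MeasureTheory Polynomial
open scoped ENNReal ComplexConjugate

noncomputable section

/-- Lebesgue measure `dθ` on one period `(0, 2π]` of the angular variable. -/
def angleMeasure : Measure ℝ := volume.restrict (Set.Ioc 0 (2 * Real.pi))

/-- Given a density `w`, the measure `w(θ) dθ` on the unit circle, seen as a measure on `ℂ`:
the image of `w(θ) dθ` under `θ ↦ exp (i θ)`. -/
def arcMeasure (w : ℝ → ℝ≥0∞) : Measure ℂ :=
  (angleMeasure.withDensity w).map (circleMap 0 1)

/-- The normalized Lebesgue measure `dθ / 2π` on the unit circle, seen as a measure on `ℂ`. -/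
def circleLebesgue : Measure ℂ := arcMeasure fun _ => (ENNReal.ofReal (2 * Real.pi))⁻¹

/-- The Sobolev inner product `∫ p \bar q dμ₀ + ∫ p' \bar{q'} dμ₁` of two polynomials. -/
def sobolevInner (μ₀ μ₁ : Measure ℂ) (p q : ℂ[X]) : ℂ :=
  (∫ z, p.eval z * conj (q.eval z) ∂μ₀) +
    ∫ z, (derivative p).eval z * conj ((derivative q).eval z) ∂μ₁

/-- `φ 0, φ 1, φ 2, …` is a sequence of orthonormal polynomials, `φ n` of degree exactly `n`,
for the Sobolev inner product of `μ₀` and `μ₁`. -/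
structure IsSobolevOrthonormal (μ₀ μ₁ : Measure ℂ) (φ : ℕ → ℂ[X]) : Prop where
  degree_eq : ∀ n, (φ n).degree = n
  inner_eq : ∀ m n, sobolevInner μ₀ μ₁ (φ m) (φ n) = if m = n then 1 else 0

/-- The set of all zeros of the members of a sequence of polynomials. -/
def zeroSet (φ : ℕ → ℂ[X]) : Set ℂ := {z | ∃ n, (φ n).eval z = 0}

/-- The Sobolev inner product of `μ₀` and `μ₁` has orthonormal polynomials, and the set of the
zeros of all of them is bounded. (They are unique up to unimodular constants, so that the set of
zeros does not depend on the chosen sequence.) -/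
def SobolevZerosBounded (μ₀ μ₁ : Measure ℂ) : Prop :=
  (∃ φ, IsSobolevOrthonormal μ₀ μ₁ φ) ∧
    ∀ φ, IsSobolevOrthonormal μ₀ μ₁ φ → Bornology.IsBounded (zeroSet φ)

end

/-! A zero `a` of `φ n` gives `φ n = p = (X - C a) * q` with `p` orthogonal to all degrees up to
that of `q`; the task is to bound `‖a‖` independently of `q`.

If `μ` weighs the functions, testing against `q` suffices: multiplication by `X` is a contraction on
both `L²` spaces, and the extra term `∫ q \bar{q'} dm` from the product rule is controlled because
`m ≤ K μ` (`norm_root_le_of_circleLebesgue_le`).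

If `μ` weighs the derivatives, the extra term is an integral of `q` against `μ`, which `m` need not
dominate. Instead, orthogonality turns `∫ p' \bar h dμ` into an integral over the circle, by
integrating `h`; this fails only for the top coefficients of `h` (`norm_polyInner_derivative_le`).
Since `p' = (X - a) q' + q`, the numbers `u i = ∫ p' \bar{z^i q'} dμ` satisfy a recurrence with
factor `conj a`. They are bounded in `i`, so a large `‖a‖` makes them small
(`norm_le_of_backward_recurrence`), and the test against `q` then becomes contradictory
(`norm_root_le_of_derivative_measure`). -/

/-! ### Integrability and Cauchy-Schwarz on the disk -/

section FiniteMeasureOnDisk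

variable {μ : Measure ℂ}

lemma ae_norm_le_one_of_support_subset (hμ : μ.support ⊆ Metric.closedBall (0 : ℂ) 1) :
    ∀ᵐ z ∂μ, ‖z‖ ≤ 1 := by
  filter_upwards [Measure.support_mem_ae (μ := μ)] with z hz
  simpa using hμ hz

variable [IsFiniteMeasure μ]

lemma integrable_of_continuous_of_disk {E : Type*} [NormedAddCommGroup E]
    [SecondCountableTopologyEither ℂ E] (hμ : ∀ᵐ z ∂μ, ‖z‖ ≤ 1) {f : ℂ → E} (hf : Continuous f) :
    Integrable f μ := by
  obtain ⟨K, hK⟩ := (isCompact_closedBall (0 : ℂ) 1).exists_bound_of_continuousOn hf.continuousOn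
  refine Integrable.of_bound hf.aestronglyMeasurable K ?_
  filter_upwards [hμ] with z hz
  exact hK z (by simpa using hz)

/-- Cauchy-Schwarz for polynomials on the disk. -/
lemma sq_integral_norm_eval_mul_le (hμ : ∀ᵐ z ∂μ, ‖z‖ ≤ 1) (p q : ℂ[X]) :
    (∫ z, ‖p.eval z‖ * ‖q.eval z‖ ∂μ) ^ 2 ≤
      (∫ z, ‖p.eval z‖ ^ 2 ∂μ) * ∫ z, ‖q.eval z‖ ^ 2 ∂μ := by
  have hm : ∀ r : ℂ[X], MemLp (fun z => r.eval z) (ENNReal.ofReal 2) μ := by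
    intro r
    rw [show ENNReal.ofReal 2 = 2 by simp]
    refine (memLp_two_iff_integrable_sq_norm r.continuous.aestronglyMeasurable).2 ?_
    exact integrable_of_continuous_of_disk hμ (r.continuous.norm.pow 2)
  have h := integral_mul_norm_le_Lp_mul_Lq Real.HolderConjugate.two_two (hm p) (hm q)
  have h0 : 0 ≤ ∫ z, ‖p.eval z‖ * ‖q.eval z‖ ∂μ := integral_nonneg fun z => by positivity
  have hp : 0 ≤ ∫ z, ‖p.eval z‖ ^ 2 ∂μ := integral_nonneg fun z => by positivity
  have hq : 0 ≤ ∫ z, ‖q.eval z‖ ^ 2 ∂μ := integral_nonneg fun z => by positivity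
  simp only [Real.rpow_two, ← Real.sqrt_eq_rpow] at h
  calc _ ≤ (√(∫ z, ‖p.eval z‖ ^ 2 ∂μ) * √(∫ z, ‖q.eval z‖ ^ 2 ∂μ)) ^ 2 :=
        pow_le_pow_left₀ h0 h 2
    _ = _ := by rw [mul_pow, Real.sq_sqrt hp, Real.sq_sqrt hq]

end FiniteMeasureOnDisk

/-! ### The `L²` pairing of polynomials -/

section Sesquilinear

/-- The `L²` pairing `∫ p \bar q dμ` of polynomials. -/
noncomputable def polyInner (μ : Measure ℂ) (p q : ℂ[X]) : ℂ := ∫ z, p.eval z * conj (q.eval z) ∂μ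

/-- The squared `L²` norm of a polynomial. -/
noncomputable def polySqNorm (μ : Measure ℂ) (p : ℂ[X]) : ℝ := ∫ z, ‖p.eval z‖ ^ 2 ∂μ

lemma sobolevInner_eq (μ₀ μ₁ : Measure ℂ) (p q : ℂ[X]) :
    sobolevInner μ₀ μ₁ p q = polyInner μ₀ p q + polyInner μ₁ (derivative p) (derivative q) := rfl

variable {μ : Measure ℂ}

lemma polySqNorm_nonneg (p : ℂ[X]) : 0 ≤ polySqNorm μ p :=
  integral_nonneg fun z => by positivity

lemma polyInner_self (p : ℂ[X]) : polyInner μ p p = polySqNorm μ p := by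
  unfold polyInner polySqNorm
  rw [← integral_complex_ofReal]
  congr 1 with z
  simp [Complex.mul_conj, Complex.normSq_eq_norm_sq]

lemma conj_polyInner (p q : ℂ[X]) : conj (polyInner μ p q) = polyInner μ q p := by
  unfold polyInner
  rw [← integral_conj]
  congr 1 with z
  simp [mul_comm]

lemma polyInner_smul_left (c : ℂ) (p q : ℂ[X]) :
    polyInner μ (c • p) q = c * polyInner μ p q := by
  unfold polyInner
  rw [← integral_const_mul]
  congr 1 with z
  simp [mul_assoc]

lemma polyInner_smul_right (c : ℂ) (p q : ℂ[X]) :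
    polyInner μ p (c • q) = conj c * polyInner μ p q := by
  rw [← conj_polyInner, polyInner_smul_left, map_mul, conj_polyInner]

lemma norm_polyInner_le (p q : ℂ[X]) :
    ‖polyInner μ p q‖ ≤ ∫ z, ‖p.eval z‖ * ‖q.eval z‖ ∂μ := by
  refine (norm_integral_le_integral_norm _).trans_eq ?_
  simp

variable [IsFiniteMeasure μ]

lemma polyInner_add_left (hμ : ∀ᵐ z ∂μ, ‖z‖ ≤ 1) (p q r : ℂ[X]) :
    polyInner μ (p + q) r = polyInner μ p r + polyInner μ q r := by
  unfold polyInner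
  rw [← integral_add]
  · simp [add_mul]
  all_goals
    exact integrable_of_continuous_of_disk hμ
      (by fun_prop)

lemma polyInner_add_right (hμ : ∀ᵐ z ∂μ, ‖z‖ ≤ 1) (p q r : ℂ[X]) :
    polyInner μ p (q + r) = polyInner μ p q + polyInner μ p r := by
  rw [← conj_polyInner, polyInner_add_left hμ, map_add, conj_polyInner, conj_polyInner]

lemma polyInner_sum_right (hμ : ∀ᵐ z ∂μ, ‖z‖ ≤ 1) {ι : Type*} (s : Finset ι) (p : ℂ[X])
    (f : ι → ℂ[X]) : polyInner μ p (∑ i ∈ s, f i) = ∑ i ∈ s, polyInner μ p (f i) := by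
  classical
  induction s using Finset.induction_on with
  | empty => simp [polyInner]
  | insert a s ha ih => rw [Finset.sum_insert ha, Finset.sum_insert ha, polyInner_add_right hμ, ih]

lemma norm_polyInner_sq_le (hμ : ∀ᵐ z ∂μ, ‖z‖ ≤ 1) (p q : ℂ[X]) :
    ‖polyInner μ p q‖ ^ 2 ≤ polySqNorm μ p * polySqNorm μ q :=
  (pow_le_pow_left₀ (norm_nonneg _) (norm_polyInner_le p q) 2).trans
    (sq_integral_norm_eval_mul_le hμ p q)

lemma norm_polyInner_X_pow_mul_le (hμ : ∀ᵐ z ∂μ, ‖z‖ ≤ 1) (p q : ℂ[X]) (i : ℕ) :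
    ‖polyInner μ p (X ^ i * q)‖ ≤ ∫ z, ‖p.eval z‖ * ‖q.eval z‖ ∂μ := by
  refine (norm_polyInner_le _ _).trans (integral_mono_ae ?_ ?_ ?_)
  · exact integrable_of_continuous_of_disk hμ (by fun_prop)
  · exact integrable_of_continuous_of_disk hμ (by fun_prop)
  · filter_upwards [hμ] with z hz
    simp only [eval_mul, eval_pow, eval_X, norm_mul, norm_pow]
    gcongr
    exact mul_le_of_le_one_left (norm_nonneg _) (pow_le_one₀ (norm_nonneg _) hz)

lemma norm_polyInner_X_pow_mul_self_le (hμ : ∀ᵐ z ∂μ, ‖z‖ ≤ 1) (p : ℂ[X]) (i : ℕ) :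
    ‖polyInner μ p (X ^ i * p)‖ ≤ polySqNorm μ p := by
  refine (norm_polyInner_X_pow_mul_le hμ p p i).trans_eq ?_
  simp [polySqNorm, sq]

end Sesquilinear

/-! ### Fourier analysis on the unit circle -/

section Circle

lemma continuous_circleMap_zero_one : Continuous (circleMap 0 1) := continuous_circleMap 0 1

instance : IsFiniteMeasure angleMeasure := by unfold angleMeasure; infer_instance

lemma circleLebesgue_eq : circleLebesgue =
    (ENNReal.ofReal (2 * Real.pi))⁻¹ • angleMeasure.map (circleMap 0 1) := by
  rw [circleLebesgue, arcMeasure, withDensity_const, Measure.map_smul]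

instance : IsFiniteMeasure circleLebesgue := by
  rw [circleLebesgue_eq]
  refine ⟨?_⟩
  rw [Measure.smul_apply, smul_eq_mul]
  refine ENNReal.mul_lt_top ?_ (measure_lt_top _ _)
  simp [Real.pi_pos]

lemma ae_circleLebesgue_norm_eq_one : ∀ᵐ z ∂circleLebesgue, ‖z‖ = 1 := by
  rw [circleLebesgue, arcMeasure, ae_map_iff continuous_circleMap_zero_one.measurable.aemeasurable]
  · simp
  · exact (isClosed_eq continuous_norm continuous_const).measurableSet

lemma ae_circleLebesgue_norm_le_one : ∀ᵐ z ∂circleLebesgue, ‖z‖ ≤ 1 :=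
  ae_circleLebesgue_norm_eq_one.mono fun _ h => h.le

lemma integral_circleLebesgue {f : ℂ → ℂ} (hf : Continuous f) :
    ∫ z, f z ∂circleLebesgue =
      (2 * Real.pi : ℝ)⁻¹ • ∫ θ in (0 : ℝ)..2 * Real.pi, f (circleMap 0 1 θ) := by
  rw [circleLebesgue_eq, integral_smul_measure,
    integral_map continuous_circleMap_zero_one.measurable.aemeasurable hf.aestronglyMeasurable,
    intervalIntegral.integral_of_le (by positivity), angleMeasure, ENNReal.toReal_inv,
    ENNReal.toReal_ofReal (by positivity)]

lemma polyInner_circle_X_pow_X_pow (j k : ℕ) :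
    polyInner circleLebesgue (X ^ j) (X ^ k) = if j = k then 1 else 0 := by
  have hpi : (2 * Real.pi : ℂ) ≠ 0 := by simp [Real.pi_ne_zero]
  unfold polyInner
  rw [integral_circleLebesgue (by fun_prop)]
  have h : ∀ θ : ℝ, (X ^ j : ℂ[X]).eval (circleMap 0 1 θ) *
      conj ((X ^ k : ℂ[X]).eval (circleMap 0 1 θ)) =
        Complex.exp ((((j : ℂ) - k) * Complex.I) * θ) := by
    intro θ
    simp only [circleMap, eval_pow, eval_X, Complex.ofReal_one, one_mul, zero_add,
      ← Complex.exp_conj, ← Complex.exp_nat_mul, ← Complex.exp_add]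
    congr 1
    simp
    ring
  simp only [h]
  split_ifs with hjk
  · simp only [hjk, sub_self, zero_mul, Complex.exp_zero, intervalIntegral.integral_const,
      Complex.real_smul]
    push_cast
    field_simp
    simp
  · have hne : ((j : ℂ) - k) * Complex.I ≠ 0 :=
      mul_ne_zero (sub_ne_zero.2 (by exact_mod_cast hjk)) Complex.I_ne_zero
    rw [integral_exp_mul_complex hne]
    have : Complex.exp (((j : ℂ) - k) * Complex.I * ((2 * Real.pi : ℝ) : ℂ)) = 1 := by
      rw [Complex.exp_eq_one_iff]
      exact ⟨(j : ℤ) - k, by push_cast; ring⟩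
    rw [this]
    simp

lemma polyInner_circle_X_pow (p : ℂ[X]) (k : ℕ) :
    polyInner circleLebesgue p (X ^ k) = p.coeff k := by
  induction p using Polynomial.induction_on' with
  | add p q hp hq => rw [polyInner_add_left ae_circleLebesgue_norm_le_one, hp, hq, coeff_add]
  | monomial j a =>
    rw [← C_mul_X_pow_eq_monomial, ← smul_eq_C_mul, polyInner_smul_left,
      polyInner_circle_X_pow_X_pow]
    simp [coeff_X_pow, eq_comm]

/-- Parseval's identity on the circle. -/
lemma polySqNorm_circle (p : ℂ[X]) {N : ℕ} (hN : p.natDegree < N) :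
    polySqNorm circleLebesgue p = ∑ k ∈ Finset.range N, ‖p.coeff k‖ ^ 2 := by
  have h : polyInner circleLebesgue p p = ∑ k ∈ Finset.range N, conj (p.coeff k) * p.coeff k := by
    conv_lhs => arg 3; rw [p.as_sum_range_C_mul_X_pow' hN]
    simp only [polyInner_sum_right ae_circleLebesgue_norm_le_one, ← smul_eq_C_mul,
      polyInner_smul_right, polyInner_circle_X_pow]
  rw [polyInner_self] at h
  apply_fun Complex.re at h
  simpa [← Complex.normSq_eq_conj_mul_self, Complex.normSq_eq_norm_sq, ← Complex.ofReal_pow]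
    using h

lemma norm_coeff_le_sqrt_polySqNorm_circle (p : ℂ[X]) (k : ℕ) :
    ‖p.coeff k‖ ≤ √(polySqNorm circleLebesgue p) := by
  refine Real.le_sqrt_of_sq_le ?_
  rw [polySqNorm_circle p (N := max k p.natDegree + 1) (by omega)]
  exact Finset.single_le_sum (f := fun k => ‖p.coeff k‖ ^ 2) (fun _ _ => by positivity)
    (Finset.mem_range.2 (by omega))

lemma polySqNorm_circle_pos {p : ℂ[X]} (hp : p ≠ 0) : 0 < polySqNorm circleLebesgue p := by
  have h := norm_coeff_le_sqrt_polySqNorm_circle p p.natDegree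
  have : 0 < ‖p.coeff p.natDegree‖ := by simpa using hp
  exact Real.sqrt_pos.1 (this.trans_le h)

lemma polySqNorm_circle_X_pow_mul (p : ℂ[X]) (i : ℕ) :
    polySqNorm circleLebesgue (X ^ i * p) = polySqNorm circleLebesgue p := by
  refine integral_congr_ae ?_
  filter_upwards [ae_circleLebesgue_norm_eq_one] with z hz
  simp [hz]

lemma polySqNorm_circle_X_sub_C_mul_le (p : ℂ[X]) (a : ℂ) :
    polySqNorm circleLebesgue ((X - C a) * p) ≤ (‖a‖ + 1) ^ 2 * polySqNorm circleLebesgue p := by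
  unfold polySqNorm
  rw [← integral_const_mul]
  refine integral_mono_ae (integrable_of_continuous_of_disk ae_circleLebesgue_norm_le_one
    (by fun_prop)) (integrable_of_continuous_of_disk ae_circleLebesgue_norm_le_one
    (by fun_prop)) ?_
  filter_upwards [ae_circleLebesgue_norm_eq_one] with z hz
  simp only [eval_mul, eval_sub, eval_X, eval_C, norm_mul, mul_pow]
  gcongr
  linarith [norm_sub_le z a]

end Circle

/-! ### Orthonormal sequences and their zeros -/

section OrthogonalSequence

variable {μ₀ μ₁ : Measure ℂ}

lemma sobolevInner_smul_right (c : ℂ) (p q : ℂ[X]) :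
    sobolevInner μ₀ μ₁ p (c • q) = conj c * sobolevInner μ₀ μ₁ p q := by
  simp only [sobolevInner_eq, derivative_smul, polyInner_smul_right]
  ring

variable [IsFiniteMeasure μ₀] [IsFiniteMeasure μ₁]

lemma sobolevInner_add_right (h₀ : ∀ᵐ z ∂μ₀, ‖z‖ ≤ 1) (h₁ : ∀ᵐ z ∂μ₁, ‖z‖ ≤ 1) (p q r : ℂ[X]) :
    sobolevInner μ₀ μ₁ p (q + r) = sobolevInner μ₀ μ₁ p q + sobolevInner μ₀ μ₁ p r := by
  simp only [sobolevInner_eq, derivative_add, polyInner_add_right h₀, polyInner_add_right h₁]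
  ring

lemma IsSobolevOrthonormal.inner_eq_zero_of_degree_lt (h₀ : ∀ᵐ z ∂μ₀, ‖z‖ ≤ 1)
    (h₁ : ∀ᵐ z ∂μ₁, ‖z‖ ≤ 1) {φ : ℕ → ℂ[X]} (hφ : IsSobolevOrthonormal μ₀ μ₁ φ) (n : ℕ)
    (r : ℂ[X]) (hr : r.degree < n) : sobolevInner μ₀ μ₁ (φ n) r = 0 := by
  suffices H : ∀ k ≤ n, ∀ r : ℂ[X], r.degree < k → sobolevInner μ₀ μ₁ (φ n) r = 0 from
    H n le_rfl r hr
  intro k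
  induction k with
  | zero =>
    intro _ r hr
    have : r = 0 := by simpa [Nat.WithBot.lt_zero_iff] using hr
    simp [this, sobolevInner]
  | succ k ih =>
    intro hk r hr
    have hdk := hφ.degree_eq k
    have hlead : (φ k).coeff k ≠ 0 := coeff_ne_zero_of_eq_degree hdk
    set c := r.coeff k / (φ k).coeff k
    have hs : (r - c • φ k).degree < k := by
      rw [degree_lt_iff_coeff_zero]
      intro m hm
      rcases hm.eq_or_lt with rfl | hm
      · simp [c, hlead]
      · have h1 : r.coeff m = 0 := coeff_eq_zero_of_degree_lt
          (hr.trans_le (by exact_mod_cast hm))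
        have h2 : (φ k).coeff m = 0 := coeff_eq_zero_of_degree_lt
          (by rw [hdk]; exact_mod_cast hm)
        simp [h1, h2]
    have := ih (by omega) _ hs
    have e : r = (r - c • φ k) + c • φ k := by ring
    rw [e, sobolevInner_add_right h₀ h₁, this, sobolevInner_smul_right, hφ.inner_eq,
      if_neg (by omega)]
    simp

/-- The Gram-Schmidt process produces orthonormal polynomials of every degree as soon as the
Sobolev inner product is positive definite. -/
lemma exists_isSobolevOrthonormal (h₀ : ∀ᵐ z ∂μ₀, ‖z‖ ≤ 1) (h₁ : ∀ᵐ z ∂μ₁, ‖z‖ ≤ 1)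
    (hpos : ∀ p : ℂ[X], p ≠ 0 → 0 < polySqNorm μ₀ p) : ∃ φ, IsSobolevOrthonormal μ₀ μ₁ φ := by
  have hself : ∀ p, sobolevInner μ₀ μ₁ p p =
      ((polySqNorm μ₀ p + polySqNorm μ₁ (derivative p) : ℝ) : ℂ) := by
    intro p
    rw [sobolevInner_eq, polyInner_self, polyInner_self]
    push_cast
    rfl
  let core : InnerProductSpace.Core ℂ ℂ[X] :=
    -- The arguments are swapped because `inner` is conjugate-linear in its first slot.
    { inner := fun p q => sobolevInner μ₀ μ₁ q p
      conj_inner_symm := fun p q => by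
        simp only [sobolevInner_eq, map_add, conj_polyInner]
      re_inner_nonneg := fun p => by
        change 0 ≤ (sobolevInner μ₀ μ₁ p p).re
        rw [hself, Complex.ofReal_re]
        exact add_nonneg (polySqNorm_nonneg _) (polySqNorm_nonneg _)
      add_left := fun p q r => sobolevInner_add_right h₀ h₁ r p q
      smul_left := fun p q c => sobolevInner_smul_right c q p
      definite := fun p hp => by
        by_contra hne
        change sobolevInner μ₀ μ₁ p p = 0 at hp
        rw [hself, Complex.ofReal_eq_zero] at hp
        linarith [hpos p hne, polySqNorm_nonneg (μ := μ₁) (derivative p)] }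
  let _ : NormedAddCommGroup ℂ[X] := core.toNormedAddCommGroup
  let _ : InnerProductSpace ℂ ℂ[X] := InnerProductSpace.ofCore core.toCore
  have hdeg : ∀ n : ℕ,
      (InnerProductSpace.gramSchmidt ℂ (fun k : ℕ => (X : ℂ[X]) ^ k) n).degree = n := by
    intro n
    induction n using Nat.strong_induction_on with
    | _ n ih =>
      have h := InnerProductSpace.gramSchmidt_def'' ℂ (fun k : ℕ => (X : ℂ[X]) ^ k) n
      rw [eq_comm, ← eq_sub_iff_add_eq] at h
      rw [h, degree_sub_eq_left_of_degree_lt, degree_X_pow]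
      rw [degree_X_pow, ← mem_degreeLT]
      refine Submodule.sum_mem _ fun i hi => Submodule.smul_mem _ _ ?_
      rw [mem_degreeLT, ih i (Finset.mem_Iio.1 hi)]
      exact_mod_cast Finset.mem_Iio.1 hi
  have hlin : LinearIndependent ℂ (fun k : ℕ => (X : ℂ[X]) ^ k) := by
    have := (Polynomial.basisMonomials ℂ).linearIndependent
    rw [Polynomial.coe_basisMonomials] at this
    simpa [← X_pow_eq_monomial] using this
  have ho := InnerProductSpace.gramSchmidtNormed_orthonormal hlin
  refine ⟨InnerProductSpace.gramSchmidtNormed ℂ (fun k : ℕ => (X : ℂ[X]) ^ k), ?_, ?_⟩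
  · intro n
    have hne : InnerProductSpace.gramSchmidt ℂ (fun k : ℕ => (X : ℂ[X]) ^ k) n ≠ 0 := by
      intro h0
      have := hdeg n
      simp [h0] at this
    rw [InnerProductSpace.gramSchmidtNormed, smul_eq_C_mul, degree_C_mul, hdeg]
    simpa using hne
  · intro m n
    have := orthonormal_iff_ite.1 ho n m
    simp only [eq_comm (a := n)] at this
    exact this

end OrthogonalSequence

/-- Zeros are bounded once all polynomials that are orthogonal to every polynomial of lower degree
have their zeros in one disk. -/
lemma sobolevZerosBounded_of_forall_root {μ₀ μ₁ : Measure ℂ} [IsFiniteMeasure μ₀]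
    [IsFiniteMeasure μ₁] (h₀ : ∀ᵐ z ∂μ₀, ‖z‖ ≤ 1) (h₁ : ∀ᵐ z ∂μ₁, ‖z‖ ≤ 1)
    (hpos : ∀ p : ℂ[X], p ≠ 0 → 0 < polySqNorm μ₀ p) (R : ℝ)
    (hR : ∀ (q : ℂ[X]) (a : ℂ), q ≠ 0 → (∀ r : ℂ[X], r.natDegree ≤ q.natDegree →
      sobolevInner μ₀ μ₁ ((X - C a) * q) r = 0) → ‖a‖ ≤ R) :
    SobolevZerosBounded μ₀ μ₁ := by
  refine ⟨exists_isSobolevOrthonormal h₀ h₁ hpos, fun φ hφ => ?_⟩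
  refine (Metric.isBounded_closedBall (x := (0 : ℂ)) (r := R)).subset ?_
  rintro a ⟨n, hn⟩
  rw [mem_closedBall_zero_iff]
  obtain ⟨q, hq⟩ := dvd_iff_isRoot.2 hn
  have hφ0 : φ n ≠ 0 := by
    intro h
    have := hφ.degree_eq n
    simp [h] at this
  have hq0 : q ≠ 0 := by
    rintro rfl
    simp [hφ0] at hq
  refine hR q a hq0 fun r hr => ?_
  rw [← hq]
  refine hφ.inner_eq_zero_of_degree_lt h₀ h₁ n r ?_
  have hdeg : n = q.natDegree + 1 := by
    have h := hφ.degree_eq n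
    rw [degree_eq_natDegree hφ0, Nat.cast_inj] at h
    rw [← h, hq, natDegree_mul (X_sub_C_ne_zero a) hq0, natDegree_X_sub_C, add_comm]
  refine degree_le_natDegree.trans_lt ?_
  exact_mod_cast (by omega : r.natDegree < n)

/-! ### Zeros when `μ` weighs the functions -/

section MeasureInFunctionTerm

variable {μ : Measure ℂ} [IsFiniteMeasure μ]

lemma polySqNorm_circle_le (hμ : ∀ᵐ z ∂μ, ‖z‖ ≤ 1) {K : ℝ≥0∞} (hK : K ≠ ∞)
    (h : circleLebesgue ≤ K • μ) (p : ℂ[X]) :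
    polySqNorm circleLebesgue p ≤ K.toReal * polySqNorm μ p := by
  unfold polySqNorm
  rw [← smul_eq_mul, ← integral_smul_measure]
  refine integral_mono_measure h (Filter.Eventually.of_forall fun z => by positivity) ?_
  exact (integrable_of_continuous_of_disk hμ (by fun_prop)).smul_measure hK

lemma norm_root_le_of_circleLebesgue_le (hμ : ∀ᵐ z ∂μ, ‖z‖ ≤ 1) {K : ℝ≥0∞} (hK : K ≠ ∞)
    (h : circleLebesgue ≤ K • μ) {q : ℂ[X]} {a : ℂ} (hq : q ≠ 0)
    (horth : ∀ r : ℂ[X], r.natDegree ≤ q.natDegree →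
      sobolevInner μ circleLebesgue ((X - C a) * q) r = 0) : ‖a‖ ≤ 2 + K.toReal := by
  have hm := ae_circleLebesgue_norm_le_one
  have h0 := horth q le_rfl
  set N := polySqNorm μ q
  set Q := polySqNorm circleLebesgue q
  set D := polySqNorm circleLebesgue (derivative q)
  have hN : 0 ≤ N := polySqNorm_nonneg _
  have hD : 0 ≤ D := polySqNorm_nonneg _
  have hQ : 0 < Q := polySqNorm_circle_pos hq
  have hQN : Q ≤ K.toReal * N := polySqNorm_circle_le hμ hK h q
  have e1 : (X - C a) * q = X ^ 1 * q + (-a) • q := by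
    rw [smul_eq_C_mul, C_neg]; ring
  have e2 : derivative ((X - C a) * q) =
      X ^ 1 * derivative q + (-a) • derivative q + q := by
    rw [smul_eq_C_mul, C_neg, derivative_mul, derivative_X_sub_C]; ring
  rw [sobolevInner_eq, e2, e1, polyInner_add_left hμ, polyInner_add_left hm,
    polyInner_add_left hm, polyInner_smul_left, polyInner_smul_left, polyInner_self,
    polyInner_self] at h0
  have h1 : ‖polyInner μ (X ^ 1 * q) q‖ ≤ N := by
    rw [← conj_polyInner, Complex.norm_conj]
    exact norm_polyInner_X_pow_mul_self_le hμ q 1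
  have h2 : ‖polyInner circleLebesgue (X ^ 1 * derivative q) (derivative q)‖ ≤ D := by
    rw [← conj_polyInner, Complex.norm_conj]
    exact norm_polyInner_X_pow_mul_self_le hm _ 1
  -- Cauchy-Schwarz, then `Q * D ≤ (Q + D) ^ 2`.
  have h3 : ‖polyInner circleLebesgue q (derivative q)‖ ≤ Q + D := by
    have := norm_polyInner_sq_le hm q (derivative q)
    refine abs_le_of_sq_le_sq' (this.trans ?_) (by linarith) |>.2
    nlinarith [mul_nonneg hQ.le hD]
  have h4 : a * ((N + D : ℝ) : ℂ) = polyInner μ (X ^ 1 * q) q +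
      polyInner circleLebesgue (X ^ 1 * derivative q) (derivative q) +
      polyInner circleLebesgue q (derivative q) := by
    push_cast
    linear_combination -h0
  have h5 : ‖a‖ * (N + D) ≤ N + D + (Q + D) := by
    have h6 := congrArg norm h4
    rw [norm_mul, Complex.norm_real, Real.norm_of_nonneg (by positivity)] at h6
    rw [h6]
    exact (norm_add₃_le).trans (by linarith)
  have hK0 : 0 ≤ K.toReal := ENNReal.toReal_nonneg
  have hNpos : 0 < N := by
    by_contra hcon
    have : N = 0 := le_antisymm (not_lt.1 hcon) hN
    rw [this] at hQN
    linarith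
  have : ‖a‖ * (N + D) ≤ (2 + K.toReal) * (N + D) := by nlinarith [mul_nonneg hK0 hD]
  exact le_of_mul_le_mul_right this (by linarith)

end MeasureInFunctionTerm

/-! ### Zeros when `μ` weighs the derivatives -/

section MeasureInDerivativeTerm

variable {μ : Measure ℂ} [IsFiniteMeasure μ]

/-- If `p` is Sobolev orthogonal to the polynomials of degree at most `d`, then the functional
`h ↦ ∫ p' \bar h dμ` is bounded in terms of the `L²` norm of `h` on the circle, with a loss that
is linear in the excess of the degree of `h` over `d`. -/
lemma norm_polyInner_derivative_le (hμ : ∀ᵐ z ∂μ, ‖z‖ ≤ 1) {p : ℂ[X]} {d : ℕ}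
    (horth : ∀ r : ℂ[X], r.natDegree ≤ d → sobolevInner circleLebesgue μ p r = 0)
    {h : ℂ[X]} {i : ℕ} (hh : h.natDegree ≤ d + i) :
    ‖polyInner μ (derivative p) h‖ ≤ √(polySqNorm circleLebesgue h) *
      (√(polySqNorm circleLebesgue p) + (i + 1) * ∫ z, ‖(derivative p).eval z‖ ∂μ) := by
  set B := ∫ z, ‖(derivative p).eval z‖ ∂μ
  -- `r` is an antiderivative of the part of `h` of degree below `d`, so it is an admissible test
  -- polynomial. The tail `t` keeps the `i + 1` degrees from `d` to `d + i`.
  set r : ℂ[X] := ∑ k ∈ Finset.range d, C (h.coeff k / (k + 1)) * X ^ (k + 1)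
  set t : ℂ[X] := ∑ k ∈ Finset.range (i + 1), h.coeff (d + k) • X ^ (d + k)
  have hr : r.natDegree ≤ d := by
    refine natDegree_sum_le_of_forall_le _ _ fun k hk => ?_
    exact (natDegree_C_mul_X_pow_le _ _).trans (Finset.mem_range.1 hk)
  have hrt : h = derivative r + t := by
    conv_lhs => rw [h.as_sum_range_C_mul_X_pow' (n := d + (i + 1)) (by omega),
      Finset.sum_range_add]
    congr 1
    · simp only [r, derivative_sum, derivative_C_mul_X_pow]
      refine Finset.sum_congr rfl fun k _ => ?_
      have : (k : ℂ) + 1 ≠ 0 := Nat.cast_add_one_ne_zero k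
      simp [this]
    · simp only [t, smul_eq_C_mul]
  have hrcoeff : ∀ k, k < d → r.coeff (k + 1) = h.coeff k / (k + 1) := by
    intro k hk
    simp [r, coeff_X_pow, hk]
  -- By Parseval: integration shifts the coefficients and divides them by `k + 1 ≥ 1`.
  have hrnorm : polySqNorm circleLebesgue r ≤ polySqNorm circleLebesgue h := by
    rw [polySqNorm_circle r (N := d + 1) (by omega),
      polySqNorm_circle h (N := d + (i + 1)) (by omega), Finset.sum_range_succ',
      Finset.sum_range_add]
    have hr0 : r.coeff 0 = 0 := by simp [r, coeff_X_pow]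
    rw [hr0, norm_zero, zero_pow two_ne_zero, add_zero]
    refine le_add_of_le_of_nonneg (Finset.sum_le_sum fun k hk => ?_)
      (Finset.sum_nonneg fun _ _ => by positivity)
    rw [hrcoeff k (Finset.mem_range.1 hk), norm_div]
    gcongr
    refine div_le_self (norm_nonneg _) ?_
    have : ‖(k : ℂ) + 1‖ = (k : ℝ) + 1 := by
      rw [← Nat.cast_add_one, Complex.norm_natCast]; push_cast; rfl
    rw [this]
    linarith [(Nat.cast_nonneg k : (0 : ℝ) ≤ k)]
  have h1 : ‖polyInner μ (derivative p) (derivative r)‖ ≤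
      √(polySqNorm circleLebesgue h) * √(polySqNorm circleLebesgue p) := by
    have h0 := horth r hr
    rw [sobolevInner_eq, add_comm, ← eq_neg_iff_add_eq_zero] at h0
    rw [h0, norm_neg, ← Real.sqrt_mul (polySqNorm_nonneg _)]
    refine Real.le_sqrt_of_sq_le ((norm_polyInner_sq_le ae_circleLebesgue_norm_le_one p r).trans ?_)
    rw [mul_comm]
    gcongr
    exact polySqNorm_nonneg _
  have h2 : ‖polyInner μ (derivative p) t‖ ≤
      √(polySqNorm circleLebesgue h) * ((i + 1) * B) := by
    simp only [t, polyInner_sum_right hμ, polyInner_smul_right]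
    refine (norm_sum_le _ _).trans ?_
    calc _ ≤ ∑ _k ∈ Finset.range (i + 1), √(polySqNorm circleLebesgue h) * B := by
          refine Finset.sum_le_sum fun k _ => ?_
          rw [norm_mul, Complex.norm_conj]
          gcongr
          · exact norm_coeff_le_sqrt_polySqNorm_circle h _
          · simpa [B] using norm_polyInner_X_pow_mul_le hμ (derivative p) 1 (d + k)
      _ = _ := by simp; ring
  conv_lhs => rw [hrt, polyInner_add_right hμ]
  refine (norm_add_le _ _).trans ?_
  rw [mul_add]
  exact add_le_add h1 h2

/-- A bounded sequence that satisfies `R ‖u i‖ ≤ ‖u (i + 1)‖ + (i + 1) E` with `R > 2` grows at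
most linearly, with an explicit constant. -/
lemma norm_le_of_backward_recurrence {u : ℕ → ℂ} {R E K : ℝ} (hR : 2 < R)
    (hK : ∀ i, ‖u i‖ ≤ K) (hu : ∀ i : ℕ, R * ‖u i‖ ≤ ‖u (i + 1)‖ + (i + 1) * E) (i : ℕ) :
    ‖u i‖ ≤ (i + 1) * (E / (R - 2)) := by
  have hpos : ∀ i : ℕ, (0 : ℝ) < i + 1 := fun i => by positivity
  have hK0 : 0 ≤ K := (norm_nonneg _).trans (hK 0)
  have hbdd : BddAbove (Set.range fun i : ℕ => ‖u i‖ / (i + 1)) := by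
    refine ⟨K, ?_⟩
    rintro _ ⟨i, rfl⟩
    refine (div_le_self (norm_nonneg _) ?_).trans (hK i)
    linarith [(Nat.cast_nonneg i : (0 : ℝ) ≤ i)]
  set s := ⨆ i : ℕ, ‖u i‖ / (i + 1)
  have hs : ∀ i : ℕ, ‖u i‖ ≤ s * (i + 1) := fun i =>
    (div_le_iff₀ (hpos i)).1 (le_ciSup hbdd i)
  have hs0 : 0 ≤ s := by simpa using (norm_nonneg _).trans (hs 0)
  have hsR : s ≤ (2 * s + E) / R := by
    -- Uses `i + 2 ≤ 2 * (i + 1)`; this factor 2 is why `R > 2` is needed.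
    refine ciSup_le fun i => ?_
    rw [div_le_div_iff₀ (hpos i) (by linarith)]
    have h1 := hs (i + 1)
    push_cast at h1
    have hi : (0 : ℝ) ≤ i := Nat.cast_nonneg i
    nlinarith [hu i, mul_nonneg hs0 hi]
  rw [le_div_iff₀ (by linarith)] at hsR
  have : s ≤ E / (R - 2) := by
    rw [le_div_iff₀ (by linarith)]
    linarith
  rw [mul_comm]
  exact (hs i).trans (mul_le_mul_of_nonneg_right this (hpos i).le)

/-- For a larger `‖a‖`, the identity `hmain` would force `R ^ 2 * Q` below a bound that is only
linear in `R`. -/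
lemma norm_root_le_of_derivative_measure (hμ : ∀ᵐ z ∂μ, ‖z‖ ≤ 1) {q : ℂ[X]} {a : ℂ} (hq : q ≠ 0)
    (horth : ∀ r : ℂ[X], r.natDegree ≤ q.natDegree →
      sobolevInner circleLebesgue μ ((X - C a) * q) r = 0) : ‖a‖ ≤ 16 + 2 * μ.real Set.univ := by
  by_contra! hR
  have hm := ae_circleLebesgue_norm_le_one
  set M := μ.real Set.univ
  set R := ‖a‖
  set p := (X - C a) * q with hp
  set A := polySqNorm μ (derivative p)
  set B := ∫ z, ‖(derivative p).eval z‖ ∂μ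
  set Q := polySqNorm circleLebesgue q
  set x := √Q
  have hM : 0 ≤ M := measureReal_nonneg
  have hA : 0 ≤ A := polySqNorm_nonneg _
  have hB : 0 ≤ B := integral_nonneg fun z => norm_nonneg _
  have hQ : 0 < Q := polySqNorm_circle_pos hq
  have hx : 0 ≤ x := Real.sqrt_nonneg _
  have hxQ : x ^ 2 = Q := Real.sq_sqrt hQ.le
  -- Cauchy-Schwarz against the constant polynomial 1.
  have hBA : B ^ 2 ≤ A * M := by
    simpa [B, A, M, polySqNorm] using sq_integral_norm_eval_mul_le hμ (derivative p) 1
  have hpnorm : √(polySqNorm circleLebesgue p) ≤ (R + 1) * x := by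
    refine Real.sqrt_le_iff.2 ⟨by positivity, ?_⟩
    rw [mul_pow, hxQ]
    exact polySqNorm_circle_X_sub_C_mul_le q a
  set β := x * ((R + 1) * x + B)
  have hβ : 0 ≤ β := by positivity
  have hb : ∀ i : ℕ, ‖polyInner μ (derivative p) (X ^ i * q)‖ ≤ (i + 1) * β := by
    intro i
    have hdeg : (X ^ i * q).natDegree ≤ q.natDegree + i := by
      rw [natDegree_X_pow_mul _ hq]
    refine (norm_polyInner_derivative_le hμ horth hdeg).trans ?_
    rw [polySqNorm_circle_X_pow_mul]
    have hi : (0 : ℝ) ≤ i := Nat.cast_nonneg i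
    calc x * (√(polySqNorm circleLebesgue p) + (i + 1) * B)
        ≤ x * ((i + 1) * ((R + 1) * x) + (i + 1) * B) := by
          gcongr
          refine hpnorm.trans (le_mul_of_one_le_left (by positivity) (by linarith))
      _ = (i + 1) * β := by ring
  have hrec : ∀ i : ℕ, conj a * polyInner μ (derivative p) (X ^ i * derivative q) =
      polyInner μ (derivative p) (X ^ (i + 1) * derivative q) +
        polyInner μ (derivative p) (X ^ i * q) -
          polyInner μ (derivative p) (X ^ i * derivative p) := by
    intro i
    have e : X ^ (i + 1) * derivative q + X ^ i * q =
        X ^ i * derivative p + a • (X ^ i * derivative q) := by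
      rw [hp, derivative_mul, derivative_X_sub_C, smul_eq_C_mul]
      ring
    have := congrArg (polyInner μ (derivative p)) e
    rw [polyInner_add_right hμ, polyInner_add_right hμ, polyInner_smul_right] at this
    rw [this]
    ring
  -- The growth lemma at `i = 1` gives the factor `2 / (R - 2)`, below `1 / 7` since `R > 16`.
  have hu : ‖polyInner μ (derivative p) (X ^ 1 * derivative q)‖ ≤ (A + β) / 7 := by
    have h := norm_le_of_backward_recurrence
      (u := fun i => polyInner μ (derivative p) (X ^ i * derivative q)) (R := R) (E := A + β)
      (by linarith) (norm_polyInner_X_pow_mul_le hμ (derivative p) (derivative q)) ?_ 1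
    · refine h.trans ?_
      push_cast
      rw [← mul_div_assoc, div_le_div_iff₀ (by linarith) (by norm_num)]
      nlinarith
    · intro i
      have h1 := congrArg norm (hrec i)
      rw [norm_mul, Complex.norm_conj] at h1
      refine h1.le.trans ((norm_sub_le _ _).trans ?_)
      have h2 := norm_add_le (polyInner μ (derivative p) (X ^ (i + 1) * derivative q))
        (polyInner μ (derivative p) (X ^ i * q))
      have h3 := norm_polyInner_X_pow_mul_self_le hμ (derivative p) i
      have hi : (0 : ℝ) ≤ i := Nat.cast_nonneg i
      nlinarith [hb i, mul_nonneg hi hA]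
  have hcirc : polyInner circleLebesgue p q =
      polyInner circleLebesgue (X ^ 1 * q) q - a * Q := by
    have e1 : p = X ^ 1 * q + (-a) • q := by
      rw [hp, smul_eq_C_mul, C_neg]; ring
    rw [e1, polyInner_add_left hm, polyInner_smul_left, polyInner_self]
    ring
  have hz : ‖polyInner circleLebesgue (X ^ 1 * q) q‖ ≤ Q := by
    rw [← conj_polyInner, Complex.norm_conj]
    exact norm_polyInner_X_pow_mul_self_le hm q 1
  -- Orthogonality to `q` expresses `u 0` through the circle; substituting it into the recurrence at
  -- `i = 0` leaves only `u 1` to estimate.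
  have hmain : ((R ^ 2 * Q + A : ℝ) : ℂ) = conj a * polyInner circleLebesgue (X ^ 1 * q) q +
      polyInner μ (derivative p) (X ^ 1 * derivative q) +
        polyInner μ (derivative p) (X ^ 0 * q) := by
    have h0 := horth q le_rfl
    have h1 := hrec 0
    have h2 : conj a * a = ((R ^ 2 : ℝ) : ℂ) := by
      rw [← Complex.normSq_eq_conj_mul_self, Complex.normSq_eq_norm_sq]
    rw [sobolevInner_eq, hcirc] at h0
    rw [pow_zero, one_mul, one_mul, one_mul, polyInner_self, zero_add] at h1
    rw [pow_zero, one_mul, Complex.ofReal_add, Complex.ofReal_mul, ← h2]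
    linear_combination h1 - conj a * h0
  have hineq : R ^ 2 * Q + A ≤ R * Q + (A + β) / 7 + β := by
    have h1 := congrArg norm hmain
    rw [Complex.norm_real, Real.norm_of_nonneg (by positivity)] at h1
    rw [h1]
    refine norm_add₃_le.trans ?_
    rw [norm_mul, Complex.norm_conj]
    have := hb 0
    have : R * ‖polyInner circleLebesgue (X ^ 1 * q) q‖ ≤ R * Q := by gcongr
    norm_num at *
    linarith
  -- Arithmetic-geometric mean inequality, weighted so that the terms in `A` are absorbed by the `A`
  -- on the left of `hineq`.
  have hxB : 2 * (x * B) ≤ A / 2 + 2 * M * Q := by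
    have h1 : (2 * (x * B)) ^ 2 ≤ (A / 2 + 2 * M * Q) ^ 2 := by
      have : (2 * (x * B)) ^ 2 ≤ 4 * (Q * (A * M)) := by
        rw [mul_pow, mul_pow, hxQ]
        nlinarith
      nlinarith [sq_nonneg (A / 2 - 2 * M * Q)]
    exact abs_le_of_sq_le_sq' h1 (by positivity) |>.2
  have hβ2 : β = (R + 1) * Q + x * B := by rw [← hxQ]; ring
  have hfin : R ^ 2 * Q ≤ (3 * R + 2 + 2 * M) * Q := by nlinarith
  have := le_of_mul_le_mul_right hfin hQ
  nlinarith

end MeasureInDerivativeTerm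

/-- The factor combines the normalization of `m` with the lower bound of the density. -/
lemma circleLebesgue_le_smul_arcMeasure {w : ℝ → ℝ≥0∞} {c : ℝ≥0∞} (hc : c ≠ 0) (hc' : c ≠ ∞)
    (h : ∀ᵐ θ ∂angleMeasure, c ≤ w θ) :
    circleLebesgue ≤ ((ENNReal.ofReal (2 * Real.pi))⁻¹ * c⁻¹) • arcMeasure w := by
  have h1 : (angleMeasure.withDensity fun _ => c) ≤ angleMeasure.withDensity w :=
    withDensity_mono h
  have h2 : c • angleMeasure.map (circleMap 0 1) ≤ arcMeasure w := by
    rw [withDensity_const] at h1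
    rw [← Measure.map_smul]
    exact Measure.map_mono h1 continuous_circleMap_zero_one.measurable
  rw [circleLebesgue_eq, mul_smul]
  gcongr
  calc _ = c⁻¹ • c • angleMeasure.map (circleMap 0 1) := by
        rw [smul_smul, ENNReal.inv_mul_cancel hc hc', one_smul]
    _ ≤ _ := by gcongr

theorem corollary9 (μ : Measure ℂ) [IsFiniteMeasure μ]
    (hμ : μ.support ⊆ Metric.closedBall (0 : ℂ) 1)
    (w : ℝ → ℝ≥0∞) (hw : Measurable w)
    (hμw : μ.restrict (Metric.sphere (0 : ℂ) 1) = arcMeasure w) :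
    (essSup w angleMeasure < ∞ → SobolevZerosBounded circleLebesgue μ) ∧
    (0 < essInf w angleMeasure → SobolevZerosBounded μ circleLebesgue) := by
  have hdisk := ae_norm_le_one_of_support_subset hμ
  refine ⟨fun _ => ?_, fun hinf => ?_⟩
  · exact sobolevZerosBounded_of_forall_root ae_circleLebesgue_norm_le_one hdisk
      (fun p hp => polySqNorm_circle_pos hp) _
      fun q a hq horth => norm_root_le_of_derivative_measure hdisk hq horth
  -- Capping at 1 makes `c` finite, hence invertible.
  · set c := min (essInf w angleMeasure) 1
    have hc : c ≠ 0 := (lt_min hinf one_pos).ne'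
    have hc' : c ≠ ∞ := ((min_le_right _ _).trans_lt ENNReal.one_lt_top).ne
    have hcw : ∀ᵐ θ ∂angleMeasure, c ≤ w θ := by
      filter_upwards [ae_essInf_le (f := w) (μ := angleMeasure)] with θ hθ
      exact (min_le_left _ _).trans hθ
    set K := (ENNReal.ofReal (2 * Real.pi))⁻¹ * c⁻¹
    have hK : K ≠ ∞ := ENNReal.mul_ne_top (by simp [Real.pi_pos]) (by simpa using hc)
    have hle : circleLebesgue ≤ K • μ := by
      refine (circleLebesgue_le_smul_arcMeasure hc hc' hcw).trans ?_
      rw [← hμw]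
      gcongr
      exact Measure.restrict_le_self
    refine sobolevZerosBounded_of_forall_root hdisk ae_circleLebesgue_norm_le_one
      (fun p hp => ?_) _ fun q a hq horth =>
        norm_root_le_of_circleLebesgue_le hdisk hK hle hq horth
    have h1 := polySqNorm_circle_pos hp
    have h2 := polySqNorm_circle_le hdisk hK hle p
    exact pos_of_mul_pos_right (h1.trans_le h2) ENNReal.toReal_nonneg
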